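/- Let $\mathcal P=(\mathbb R^2,N)$ be a normed plane whose unit circle $\{N=1\}$ is a smooth quadratically convex curve, parameterized by $p:\mathbb R\to\mathbb R^2$ smooth, where $\theta$ is the angle of the tangent: $p'(\theta)=\rho(\theta)(\cos\theta,\sin\theta)$ with $\rho(\theta)>0$, and $p(\theta+\pi)=-p(\theta)$. Let $\gamma:\mathbb R\to\mathbb R^2$ be a smooth front whose tangent line at $t$ has direction $\nu(t)=(\cos\varphi(t),\sin\varphi(t))$, where $\varphi:\mathbb R\to\mathbb R$ is smooth; that is, $\det(\nu(t),\gamma'(t))=0$ for all $t$ (points with $\gamma'(t)=0$ are allowed). Assume that $\gamma\in\mathcal H$, i.e. $\varphi'(t)\neq0$ for all $t$, and that $\gamma$ is closed (a hedgehog): for some $T>0$ one has $\gamma(t+T)=\gamma(t)$ for all $t$, and the tangent makes exactly one turn in a period, i.e. $\varphi(t+T)=\varphi(t)+2\pi$ for all $t$ or $\varphi(t+T)=\varphi(t)-2\pi$ for all $t$. Then there is a (unique) function $r:\mathbb R\to\mathbb R$, the $\mathcal P$-curvature radius of $\gamma$, with $\gamma'(t)=r(t)\,(p\circ\varphi)'(t)$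 for all $t$; it is smooth, and $\gamma$ has at least four $\mathcal P$-vertices, i.e. $r'(t)=0$ for at least four distinct parameters $t\in[0,T)$. (For $\gamma$ parameterized by its tangent angle, $\varphi(\theta)=\theta$ and $T=2\pi$: $\gamma'=r\,p'$, and $r'$ has at least four zeros in $[0,2\pi)$.) -/

import Mathlib

open scoped ContDiff

namespace MinkowskiPlane

noncomputable section

/-- The underlying real plane. -/
abbrev Plane := EuclideanSpace ℝ (Fin 2)

/-- The determinant `[x, y]` of a pair of vectors of the plane. -/
def bracket (x y : Plane) : ℝ := x 0 * y 1 - x 1 * y 0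

/-- The unit vector making the angle `θ` with the fixed direction `(1, 0)`. -/
def direction (θ : ℝ) : Plane := !₂[Real.cos θ, Real.sin θ]

/-- The unit circle `{x | N x = 1}` of the normed plane `(ℝ², N)` is a smooth quadratically convex
curve, and `p` is its parametrization by the angle of the tangent.
In `p' θ = ρ θ • direction θ` the number `ρ θ` is the Euclidean radius of curvature of the unit
circle at `p θ`. It is finite because `p` is smooth: this is quadratic convexity, in the form
`[p', p''] = ρ ^ 2 > 0`. It is positive because a smooth unit circle is regular. -/
structure IsUnitCircleParam (N : Seminorm ℝ Plane) (p : ℝ → Plane) : Prop where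
  smooth : ContDiff ℝ ∞ p
  range_eq : Set.range p = {x : Plane | N x = 1}
  symmetric : ∀ θ, p (θ + Real.pi) = -p θ
  tangent : ∀ θ, ∃ ρ : ℝ, 0 < ρ ∧ deriv p θ = ρ • direction θ

/-- A front in the class `ℋ`, in an arbitrary smooth parameter `t`. The smooth map
`ν : ℝ → ℝP¹` of the Legendrian immersion `(γ, ν)` is given by a smooth angle function `φ`:
`ν t` is the line spanned by `direction (φ t)`. The condition `φ' ≠ 0` is `ν' ≠ 0`; in particular
`(γ, ν)` is an immersion. -/
structure IsFrontH (γ : ℝ → Plane) (φ : ℝ → ℝ) : Prop where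
  smooth_curve : ContDiff ℝ ∞ γ
  smooth_angle : ContDiff ℝ ∞ φ
  legendrian : ∀ t, bracket (direction (φ t)) (deriv γ t) = 0
  angle_regular : ∀ t, deriv φ t ≠ 0

/-- The front closes up at the period `T`, after exactly one turn of its tangent (in either
sense). -/
structure ClosesAfterOneTurn (γ : ℝ → Plane) (φ : ℝ → ℝ) (T : ℝ) : Prop where
  period_pos : 0 < T
  periodic : ∀ t, γ (t + T) = γ t
  one_turn : (∀ t, φ (t + T) = φ t + 2 * Real.pi) ∨ (∀ t, φ (t + T) = φ t - 2 * Real.pi)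

/-- `r` is the curvature radius of the front `γ`, relative to the unit circle `p`: the derivative
of `γ` is `r` times the derivative of the unit circle, both with respect to the same parameter,
which matches points with the same tangent angle. As `(p ∘ φ)' ≠ 0` there is at most one
such `r`. For `φ = id` the condition is `γ' = r p'`. -/
def IsCurvatureRadius (p : ℝ → Plane) (γ : ℝ → Plane) (φ r : ℝ → ℝ) : Prop :=
  ∀ t, deriv γ t = r t • deriv (p ∘ φ) t

/-- The parameters in one period `[0, T)` at which the front with curvature radius `r` has a
vertex. -/
def vertices (r : ℝ → ℝ) (T : ℝ) : Set ℝ := {t | t ∈ Set.Ico 0 T ∧ deriv r t = 0}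

end

end MinkowskiPlane

/-!
Put `q = p ∘ φ` and let `r` be the curvature radius, so that `γ' = r q'`. For every linear
functional `ℓ` and constant `c`, the function `r' (ℓ ∘ q - c)` is the derivative of the periodic
function `r (ℓ ∘ q - c) - ℓ ∘ γ`, so it cannot be nonnegative throughout a period unless it
vanishes there.

If `r` is not constant, it has a minimum at some `a` and a maximum at some `b ∈ (a, a + T)`. As the
unit circle is strictly convex, the chord through `q a` and `q b` is the line `ℓ = c` for some `ℓ`
and `c` such that `ℓ ∘ q - c` is positive on `(a, b)` and negative on `(b, a + T)`. Hence `r` cannot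
increase on all of `(a, b)` and decrease on all of `(b, a + T)`: it moves the wrong way somewhere
between two consecutive extrema, which forces two zeros of `r'` besides `a` and `b`.
-/

namespace MinkowskiPlane

open Set Function

section RealFunctions

variable {f : ℝ → ℝ} {a b c T : ℝ}

lemma lt_of_deriv_nonneg_of_deriv_pos (hf : Differentiable ℝ f)
    (hnonneg : ∀ t ∈ Ioo a b, 0 ≤ deriv f t) (hc : c ∈ Ioo a b) (hpos : 0 < deriv f c) :
    f a < f b := by
  have hmono : MonotoneOn f (Icc a b) :=
    monotoneOn_of_deriv_nonneg (convex_Icc a b) hf.continuous.continuousOn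
      hf.differentiableOn (by simpa only [interior_Icc] using hnonneg)
  have hab : a ≤ b := (hc.1.trans hc.2).le
  refine (hmono (left_mem_Icc.2 hab) (right_mem_Icc.2 hab) hab).lt_of_ne fun heq => hpos.ne' ?_
  have hconst : ∀ t ∈ Icc a b, f t = f a := fun t ht =>
    ((hmono ht (right_mem_Icc.2 hab) ht.2).trans_eq heq.symm).antisymm
      (hmono (left_mem_Icc.2 hab) ht ht.1)
  have hlocal : f =ᶠ[nhds c] fun _ => f a :=
    Filter.eventually_of_mem (Icc_mem_nhds hc.1 hc.2) hconst
  rw [hlocal.deriv_eq, deriv_const]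

lemma exists_deriv_nonneg_of_le (hf : Differentiable ℝ f) (hab : a < b) (hle : f a ≤ f b) :
    ∃ t ∈ Ioo a b, 0 ≤ deriv f t := by
  obtain ⟨t, ht, hslope⟩ :=
    exists_deriv_eq_slope f hab hf.continuous.continuousOn hf.differentiableOn
  exact ⟨t, ht, hslope ▸ div_nonneg (sub_nonneg.2 hle) (sub_nonneg.2 hab.le)⟩

lemma exists_deriv_eq_zero_of_deriv_neg (hf : Differentiable ℝ f) (hc : c ∈ Ioo a b)
    (hac : f a ≤ f c) (hcb : f c ≤ f b) (hneg : deriv f c < 0) :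
    (∃ t ∈ Ioo a c, deriv f t = 0) ∧ ∃ t ∈ Ioo c b, deriv f t = 0 := by
  have hdarboux {s : Set ℝ} (hs : s.OrdConnected) (hcs : c ∈ s) {u : ℝ} (hus : u ∈ s)
      (hu : 0 ≤ deriv f u) : ∃ t ∈ s, deriv f t = 0 :=
    (hs.image_deriv fun t _ => hf t).out (mem_image_of_mem _ hcs) (mem_image_of_mem _ hus)
      ⟨hneg.le, hu⟩
  have hne {t : ℝ} (ht : deriv f t = 0) : t ≠ c := fun h => hneg.ne (h ▸ ht)
  constructor
  · obtain ⟨u, hu, hu'⟩ := exists_deriv_nonneg_of_le hf hc.1 hac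
    obtain ⟨t, ht, ht'⟩ := hdarboux ordConnected_Ioc (right_mem_Ioc.2 hc.1) ⟨hu.1, hu.2.le⟩ hu'
    exact ⟨t, ⟨ht.1, ht.2.lt_of_ne (hne ht')⟩, ht'⟩
  · obtain ⟨u, hu, hu'⟩ := exists_deriv_nonneg_of_le hf hc.2 hcb
    obtain ⟨t, ht, ht'⟩ := hdarboux ordConnected_Ico (left_mem_Ico.2 hc.2) ⟨hu.1.le, hu.2⟩ hu'
    exact ⟨t, ⟨ht.1.lt_of_ne (hne ht').symm, ht.2⟩, ht'⟩

lemma exists_deriv_eq_zero_of_deriv_pos (hf : Differentiable ℝ f) (hc : c ∈ Ioo a b)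
    (hac : f c ≤ f a) (hcb : f b ≤ f c) (hpos : 0 < deriv f c) :
    (∃ t ∈ Ioo a c, deriv f t = 0) ∧ ∃ t ∈ Ioo c b, deriv f t = 0 := by
  simpa only [deriv.neg, neg_eq_zero] using
    exists_deriv_eq_zero_of_deriv_neg (f := -f) hf.neg hc (neg_le_neg hac) (neg_le_neg hcb)
      (by simpa only [deriv.neg, neg_lt_zero] using hpos)

lemma periodic_deriv {E : Type*} [NormedAddCommGroup E] [NormedSpace ℝ E] {g : ℝ → E}
    (hg : Periodic g T) : Periodic (deriv g) T := fun t => by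
  rw [← deriv_comp_add_const, funext hg]

lemma exists_isMin_isMax_of_periodic (hf : Periodic f T) (hcont : Continuous f) (hT : 0 < T)
    (hconst : ¬ ∀ s t, f s = f t) :
    ∃ a, ∃ b ∈ Ioo a (a + T), (∀ t, f a ≤ f t) ∧ (∀ t, f t ≤ f b) ∧ f a < f b := by
  have hcompact := hf.compact_of_continuous hT.ne' hcont
  obtain ⟨_, ⟨a, rfl⟩, hmin⟩ := hcompact.exists_isLeast (range_nonempty f)
  obtain ⟨_, ⟨m, rfl⟩, hmax⟩ := hcompact.exists_isGreatest (range_nonempty f)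
  obtain ⟨b, hb, hmb⟩ := hf.exists_mem_Ico hT m a
  have hmin' (t : ℝ) : f a ≤ f t := hmin (mem_range_self t)
  have hmax' (t : ℝ) : f t ≤ f b := hmb ▸ hmax (mem_range_self t)
  have hlt : f a < f b := by
    refine (hmin' b).lt_of_ne fun heq => hconst fun s t => ?_
    have heq' (u : ℝ) : f u = f a := ((hmax' u).trans_eq heq.symm).antisymm (hmin' u)
    rw [heq' s, heq' t]
  exact ⟨a, b, ⟨hb.1.lt_of_ne fun hab => hlt.ne (congrArg f hab), hb.2⟩, hmin', hmax', hlt⟩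

end RealFunctions

section Counting

lemma encard_Ico_zero_le_of_periodic {P : ℝ → Prop} {T : ℝ} (hP : Periodic P T) (hT : 0 < T)
    (a : ℝ) : {t | t ∈ Ico a (a + T) ∧ P t}.encard ≤ {t | t ∈ Ico 0 T ∧ P t}.encard := by
  refine encard_le_encard_of_injOn (f := toIcoMod hT 0) (fun t ht => ⟨?_, ?_⟩)
    (LeftInvOn.injOn (f₁' := toIcoMod hT a) fun t ht => ?_)
  · simpa only [zero_add] using toIcoMod_mem_Ico hT 0 t
  · rw [toIcoMod, hP.sub_zsmul_eq]
    exact ht.2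
  · rw [toIcoMod_toIcoMod, toIcoMod_eq_self]
    exact ht.1

lemma four_le_encard_of_lt {α : Type*} [LinearOrder α] {s : Set α} {w x y z : α} (hw : w ∈ s)
    (hx : x ∈ s) (hy : y ∈ s) (hz : z ∈ s) (hwx : w < x) (hxy : x < y) (hyz : y < z) :
    4 ≤ s.encard := by
  have hmono : StrictMono ![w, x, y, z] := Fin.strictMono_iff_lt_succ.2 fun i => by
    fin_cases i <;> assumption
  have hsub : range ![w, x, y, z] ⊆ s := range_subset_iff.2 fun i => by
    fin_cases i <;> assumption
  calc (4 : ℕ∞) = (range ![w, x, y, z]).encard := by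
        rw [← image_univ, hmono.injective.encard_image, encard_univ, ENat.card_eq_coe_fintype_card,
          Fintype.card_fin]
        rfl
    _ ≤ s.encard := encard_le_encard hsub

lemma four_le_encard_Ico_of_periodic {P : ℝ → Prop} {T w x y z : ℝ} (hP : Periodic P T)
    (hwx : w < x) (hxy : x < y) (hyz : y < z) (hzT : z < w + T) (hw : P w) (hx : P x) (hy : P y)
    (hz : P z) : 4 ≤ {t | t ∈ Ico 0 T ∧ P t}.encard :=
  calc 4 ≤ {t | t ∈ Ico w (w + T) ∧ P t}.encard :=
        four_le_encard_of_lt ⟨⟨le_rfl, by linarith⟩, hw⟩ ⟨⟨by linarith, by linarith⟩, hx⟩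
          ⟨⟨by linarith, by linarith⟩, hy⟩ ⟨⟨by linarith, hzT⟩, hz⟩ hwx hxy hyz
    _ ≤ {t | t ∈ Ico 0 T ∧ P t}.encard := encard_Ico_zero_le_of_periodic hP (by linarith) w

end Counting

section ChordSeparation

variable {E : Type*} [NormedAddCommGroup E] [NormedSpace ℝ E] {q γ : ℝ → E} {r : ℝ → ℝ} {a b T : ℝ}

/-- A curve of period `T` whose chords separate it: for any two points `q a` and `q b` of one
period, some level set of a linear functional through both of them has the two open arcs between
them on its two sides. That `q b` lies on the level of `q a` is not recorded, as it follows by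
continuity. -/
def IsChordSeparated (q : ℝ → E) (T : ℝ) : Prop :=
  ∀ a, ∀ b ∈ Ioo a (a + T), ∃ ℓ : StrongDual ℝ E,
    (∀ t ∈ Ioo a b, ℓ (q a) < ℓ (q t)) ∧ ∀ t ∈ Ioo b (a + T), ℓ (q t) < ℓ (q a)

lemma hasDerivAt_mul_functional_sub_functional (hq : Differentiable ℝ q) (hγ : Differentiable ℝ γ)
    (hr : Differentiable ℝ r) (hγq : ∀ t, deriv γ t = r t • deriv q t) (ℓ : StrongDual ℝ E)
    (c t : ℝ) :
    HasDerivAt (fun s => r s * (ℓ (q s) - c) - ℓ (γ s)) (deriv r t * (ℓ (q t) - c)) t := by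
  have hℓq := ℓ.hasFDerivAt.comp_hasDerivAt t (hq t).hasDerivAt
  have hℓγ := ℓ.hasFDerivAt.comp_hasDerivAt t (hγ t).hasDerivAt
  refine (((hr t).hasDerivAt.mul (hℓq.sub_const c)).sub hℓγ).congr_deriv ?_
  rw [hγq, map_smul, smul_eq_mul]
  exact add_sub_cancel_right _ _

lemma IsChordSeparated.exists_deriv_neg_or_exists_deriv_pos (hsep : IsChordSeparated q T)
    (hq : Differentiable ℝ q) (hγ : Differentiable ℝ γ) (hr : Differentiable ℝ r)
    (hqT : Periodic q T) (hγT : Periodic γ T) (hrT : Periodic r T)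
    (hγq : ∀ t, deriv γ t = r t • deriv q t) (hb : b ∈ Ioo a (a + T)) (hrab : r a < r b)
    (hrb : deriv r b = 0) :
    (∃ t ∈ Ioo a b, deriv r t < 0) ∨ ∃ t ∈ Ioo b (a + T), 0 < deriv r t := by
  by_contra! hsign
  obtain ⟨hincr, hdecr⟩ := hsign
  obtain ⟨ℓ, hpos, hneg⟩ := hsep a b hb
  have hderiv := hasDerivAt_mul_functional_sub_functional hq hγ hr hγq ℓ (ℓ (q a))
  set F : ℝ → ℝ := fun s => r s * (ℓ (q s) - ℓ (q a)) - ℓ (γ s)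
  have hF : Differentiable ℝ F := fun t => (hderiv t).differentiableAt
  have hnonneg : ∀ t ∈ Ioo a (a + T), 0 ≤ deriv F t := fun t ht => by
    rw [(hderiv t).deriv]
    rcases lt_trichotomy t b with htb | rfl | hbt
    · exact mul_nonneg (hincr t ⟨ht.1, htb⟩) (sub_nonneg.2 (hpos t ⟨ht.1, htb⟩).le)
    · rw [hrb, zero_mul]
    · exact mul_nonneg_of_nonpos_of_nonpos (hdecr t ⟨hbt, ht.2⟩)
        (sub_nonpos.2 (hneg t ⟨hbt, ht.2⟩).le)
  obtain ⟨c, hc, hslope⟩ :=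
    exists_deriv_eq_slope r hb.1 hr.continuous.continuousOn hr.differentiableOn
  have hFc : 0 < deriv F c := by
    rw [(hderiv c).deriv, hslope]
    exact mul_pos (div_pos (sub_pos.2 hrab) (sub_pos.2 hb.1)) (sub_pos.2 (hpos c hc))
  have hFT : F (a + T) = F a := by simp only [F, hrT a, hqT a, hγT a]
  exact (lt_of_deriv_nonneg_of_deriv_pos hF hnonneg ⟨hc.1, hc.2.trans hb.2⟩ hFc).ne' hFT

theorem IsChordSeparated.four_le_encard_vertices (hsep : IsChordSeparated q T) (hT : 0 < T)
    (hq : Differentiable ℝ q) (hγ : Differentiable ℝ γ) (hr : Differentiable ℝ r)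
    (hqT : Periodic q T) (hγT : Periodic γ T) (hrT : Periodic r T)
    (hγq : ∀ t, deriv γ t = r t • deriv q t) : 4 ≤ (vertices r T).encard := by
  by_cases hconst : ∀ s t, r s = r t
  · have hderiv (t : ℝ) : deriv r t = 0 := by
      rw [funext fun s => hconst s 0, deriv_const]
    simp only [vertices, hderiv, and_true, ofPred_mem_eq, (Ico_infinite hT).encard_eq, le_top]
  obtain ⟨a, b, ⟨hab, hbT⟩, hmin, hmax, hlt⟩ :=
    exists_isMin_isMax_of_periodic hrT hr.continuous hT hconst
  have ha : deriv r a = 0 := IsLocalMin.deriv_eq_zero (.of_forall hmin)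
  have hb : deriv r b = 0 := IsLocalMax.deriv_eq_zero (.of_forall hmax)
  have hzeros : Periodic (fun t => deriv r t = 0) T := fun t =>
    congrArg (· = 0) (periodic_deriv hrT t)
  rcases hsep.exists_deriv_neg_or_exists_deriv_pos hq hγ hr hqT hγT hrT hγq ⟨hab, hbT⟩ hlt hb with
    ⟨c, hc, hneg⟩ | ⟨c, hc, hpos⟩
  · obtain ⟨⟨x, ⟨hax, hxc⟩, hx⟩, ⟨y, ⟨hcy, hyb⟩, hy⟩⟩ :=
      exists_deriv_eq_zero_of_deriv_neg hr hc (hmin c) (hmax c) hneg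
    exact four_le_encard_Ico_of_periodic hzeros hax (hxc.trans hcy) hyb hbT ha hx hy hb
  · obtain ⟨⟨x, ⟨hbx, hxc⟩, hx⟩, ⟨y, ⟨hcy, hyT⟩, hy⟩⟩ :=
      exists_deriv_eq_zero_of_deriv_pos hr hc (hmax c) (hrT a ▸ hmin c) hpos
    exact four_le_encard_Ico_of_periodic hzeros hab hbx (hxc.trans hcy) hyT ha hb hx hy

end ChordSeparation

section ConvexCurve

/-- A closed strictly convex curve, parametrized by its tangent angle. Unlike the unit circle of a
norm, it need not be centrally symmetric. -/
structure IsConvexCurveParam (p : ℝ → Plane) : Prop where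
  periodic : Periodic p (2 * Real.pi)
  tangent : ∀ θ, ∃ ρ : ℝ, 0 < ρ ∧ HasDerivAt p (ρ • direction θ) θ

lemma IsUnitCircleParam.isConvexCurveParam {N : Seminorm ℝ Plane} {p : ℝ → Plane}
    (hp : IsUnitCircleParam N p) : IsConvexCurveParam p where
  periodic θ := by rw [two_mul, ← add_assoc, hp.symmetric, hp.symmetric, neg_neg]
  tangent θ := by
    obtain ⟨ρ, hρ, htan⟩ := hp.tangent θ
    exact ⟨ρ, hρ, htan ▸ (hp.smooth.differentiable (by simp) θ).hasDerivAt⟩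

/-- The linear functional `x ↦ [x, direction α]`, whose level sets are the lines making the angle
`α`. It increases to the right of `direction α`. -/
noncomputable def height (α : ℝ) : StrongDual ℝ Plane :=
  Real.sin α • EuclideanSpace.proj 0 - Real.cos α • EuclideanSpace.proj 1

lemma height_apply (α : ℝ) (x : Plane) :
    height α x = Real.sin α * x 0 - Real.cos α * x 1 := rfl

lemma height_direction (α θ : ℝ) : height α (direction θ) = Real.sin (α - θ) :=
  (Real.sin_sub α θ).symm

lemma direction_ne_zero (θ : ℝ) : direction θ ≠ 0 := fun h => by
  have hheight := height_direction (θ + Real.pi / 2) θ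
  rw [h, map_zero, add_sub_cancel_left, Real.sin_pi_div_two] at hheight
  exact zero_ne_one hheight

lemma exists_eq_smul_direction_of_bracket_eq_zero {θ : ℝ} {x : Plane}
    (hx : bracket (direction θ) x = 0) : ∃ c : ℝ, x = c • direction θ := by
  have hx' : Real.cos θ * x 1 - Real.sin θ * x 0 = 0 := hx
  refine ⟨x 0 * Real.cos θ + x 1 * Real.sin θ, ?_⟩
  ext i
  fin_cases i
  · change x 0 = (x 0 * Real.cos θ + x 1 * Real.sin θ) * Real.cos θ
    linear_combination -x 0 * Real.sin_sq_add_cos_sq θ - Real.sin θ * hx'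
  · change x 1 = (x 0 * Real.cos θ + x 1 * Real.sin θ) * Real.sin θ
    linear_combination -x 1 * Real.sin_sq_add_cos_sq θ + Real.cos θ * hx'

namespace IsConvexCurveParam

variable {p : ℝ → Plane} (hp : IsConvexCurveParam p)
include hp

lemma differentiable : Differentiable ℝ p := fun θ =>
  (hp.tangent θ).elim fun _ h => h.2.differentiableAt

lemma exists_deriv_height_eq (α θ : ℝ) :
    ∃ ρ : ℝ, 0 < ρ ∧ deriv (fun s => height α (p s)) θ = ρ * Real.sin (α - θ) := by
  obtain ⟨ρ, hρ, htan⟩ := hp.tangent θ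
  refine ⟨ρ, hρ, ((height α).hasFDerivAt.comp_hasDerivAt θ htan).deriv.trans ?_⟩
  rw [map_smul, height_direction, smul_eq_mul]

lemma continuous_height (α : ℝ) : Continuous fun s => height α (p s) :=
  (height α).continuous.comp hp.differentiable.continuous

lemma strictMonoOn_height (α : ℝ) :
    StrictMonoOn (fun s => height α (p s)) (Icc (α - Real.pi) α) := by
  refine strictMonoOn_of_deriv_pos (convex_Icc _ _) (hp.continuous_height α).continuousOn
    fun θ hθ => ?_
  rw [interior_Icc] at hθ
  obtain ⟨ρ, hρ, hderiv⟩ := hp.exists_deriv_height_eq α θ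
  rw [hderiv]
  exact mul_pos hρ (Real.sin_pos_of_pos_of_lt_pi (by linarith [hθ.2]) (by linarith [hθ.1]))

lemma strictAntiOn_height (α : ℝ) :
    StrictAntiOn (fun s => height α (p s)) (Icc α (α + Real.pi)) := by
  refine strictAntiOn_of_deriv_neg (convex_Icc _ _) (hp.continuous_height α).continuousOn
    fun θ hθ => ?_
  rw [interior_Icc] at hθ
  obtain ⟨ρ, hρ, hderiv⟩ := hp.exists_deriv_height_eq α θ
  rw [hderiv]
  exact mul_neg_of_pos_of_neg hρ
    (Real.sin_neg_of_neg_of_neg_pi_lt (by linarith [hθ.1]) (by linarith [hθ.2]))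

lemma exists_height_eq_height {a b : ℝ} (hab : a < b) :
    ∃ α ∈ Ioo a b, height α (p a) = height α (p b) := by
  choose ρ hρ htan using hp.tangent
  have hcoord (i : Fin 2) (θ : ℝ) : HasDerivAt (fun s => p s i) (ρ θ * direction θ i) θ :=
    (EuclideanSpace.proj i : StrongDual ℝ Plane).hasFDerivAt.comp_hasDerivAt θ (htan θ)
  have hcont (i : Fin 2) : ContinuousOn (fun s => p s i) (Icc a b) := fun θ _ =>
    (hcoord i θ).continuousAt.continuousWithinAt
  obtain ⟨α, hα, hslope⟩ := exists_ratio_hasDerivAt_eq_ratio_slope _ _ hab (hcont 0)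
    (fun θ _ => hcoord 0 θ) _ _ (hcont 1) (fun θ _ => hcoord 1 θ)
  refine ⟨α, hα, mul_left_cancel₀ (hρ α).ne' ?_⟩
  have hslope' : (p b 1 - p a 1) * (ρ α * Real.cos α) = (p b 0 - p a 0) * (ρ α * Real.sin α) :=
    hslope
  rw [height_apply, height_apply]
  linear_combination hslope'

theorem isChordSeparated : IsChordSeparated p (2 * Real.pi) := by
  rintro a b ⟨hab, hbT⟩
  obtain ⟨α, ⟨haα, hαb⟩, hchord⟩ := hp.exists_height_eq_height hab
  have hmono := hp.strictMonoOn_height α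
  have hanti := hp.strictAntiOn_height α
  have hadd (θ : ℝ) : height α (p (θ + 2 * Real.pi)) = height α (p θ) := by
    rw [hp.periodic]
  have hsub (θ : ℝ) : height α (p (θ - 2 * Real.pi)) = height α (p θ) := by
    rw [hp.periodic.sub_eq]
  have ha : α - Real.pi < a := by
    by_contra! hle
    exact (hanti ⟨hαb.le, by linarith⟩ ⟨by linarith, by linarith⟩ hbT).ne ((hadd a).trans hchord)
  have hb : b < α + Real.pi := by
    by_contra! hle
    have hba : b - 2 * Real.pi < a := by linarith
    exact (hmono ⟨by linarith, by linarith⟩ ⟨ha.le, haα.le⟩ hba).ne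
      ((hsub b).trans hchord.symm)
  refine ⟨height α, fun θ hθ => ?_, fun θ hθ => ?_⟩
  · rcases le_total θ α with h | h
    · exact hmono ⟨ha.le, haα.le⟩ ⟨(ha.trans hθ.1).le, h⟩ hθ.1
    · exact hchord.trans_lt (hanti ⟨h, (hθ.2.trans hb).le⟩ ⟨hαb.le, hb.le⟩ hθ.2)
  · rcases le_total θ (α + Real.pi) with h | h
    · exact (hanti ⟨hαb.le, hb.le⟩ ⟨(hαb.trans hθ.1).le, h⟩ hθ.1).trans_eq hchord.symm
    · have hθa : θ - 2 * Real.pi < a := by linarith [hθ.2]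
      exact (hsub θ).symm.trans_lt
        (hmono ⟨by linarith, by linarith⟩ ⟨ha.le, haα.le⟩ hθa)

end IsConvexCurveParam

end ConvexCurve

section CurvatureRadius

lemma exists_contDiff_eq_smul {X E : Type*} [NormedAddCommGroup X] [NormedSpace ℝ X]
    [NormedAddCommGroup E] [InnerProductSpace ℝ E] {n : WithTop ℕ∞} {f g : X → E}
    (hf : ContDiff ℝ n f) (hg : ContDiff ℝ n g) (hne : ∀ x, g x ≠ 0)
    (hfg : ∀ x, ∃ c : ℝ, f x = c • g x) :
    ∃ r : X → ℝ, ContDiff ℝ n r ∧ ∀ x, f x = r x • g x := by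
  have hinner (x : X) : inner ℝ (g x) (g x) ≠ 0 := inner_self_ne_zero.2 (hne x)
  refine ⟨fun x => inner ℝ (g x) (f x) / inner ℝ (g x) (g x),
    (hg.inner ℝ hf).div (hg.inner ℝ hg) hinner, fun x => ?_⟩
  obtain ⟨c, hc⟩ := hfg x
  simp only [hc, inner_smul_right, mul_div_cancel_right₀ c (hinner x)]

variable {p γ : ℝ → Plane} {φ r s : ℝ → ℝ} {T : ℝ}

lemma IsConvexCurveParam.exists_deriv_comp_eq (hp : IsConvexCurveParam p)
    (hγ : IsFrontH γ φ) (t : ℝ) :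
    ∃ c : ℝ, c ≠ 0 ∧ deriv (p ∘ φ) t = c • direction (φ t) := by
  obtain ⟨ρ, hρ, htan⟩ := hp.tangent (φ t)
  have hφ := (hγ.smooth_angle.differentiable (by simp) t).hasDerivAt
  exact ⟨deriv φ t * ρ, mul_ne_zero (hγ.angle_regular t) hρ.ne',
    (htan.scomp t hφ).deriv.trans (smul_smul _ _ _)⟩

lemma IsConvexCurveParam.deriv_comp_ne_zero (hp : IsConvexCurveParam p)
    (hγ : IsFrontH γ φ) (t : ℝ) : deriv (p ∘ φ) t ≠ 0 := by
  obtain ⟨c, hc, hderiv⟩ := hp.exists_deriv_comp_eq hγ t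
  exact hderiv ▸ smul_ne_zero hc (direction_ne_zero _)

lemma IsConvexCurveParam.exists_isCurvatureRadius (hp : IsConvexCurveParam p)
    (hsmooth : ContDiff ℝ ∞ p) (hγ : IsFrontH γ φ) :
    ∃ r : ℝ → ℝ, ContDiff ℝ ∞ r ∧ IsCurvatureRadius p γ φ r := by
  refine exists_contDiff_eq_smul hγ.smooth_curve.deriv' (hsmooth.comp hγ.smooth_angle).deriv'
    (hp.deriv_comp_ne_zero hγ) fun t => ?_
  obtain ⟨c, hc, hderiv⟩ := hp.exists_deriv_comp_eq hγ t
  obtain ⟨d, hd⟩ := exists_eq_smul_direction_of_bracket_eq_zero (hγ.legendrian t)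
  exact ⟨d / c, by rw [hderiv, smul_smul, div_mul_cancel₀ d hc, hd]⟩

lemma IsCurvatureRadius.unique (hr : IsCurvatureRadius p γ φ r) (hs : IsCurvatureRadius p γ φ s)
    (hne : ∀ t, deriv (p ∘ φ) t ≠ 0) : r = s :=
  funext fun t => smul_left_injective ℝ (hne t) ((hr t).symm.trans (hs t))

lemma IsCurvatureRadius.periodic (hr : IsCurvatureRadius p γ φ r)
    (hne : ∀ t, deriv (p ∘ φ) t ≠ 0) (hγT : Periodic γ T) (hpT : Periodic (p ∘ φ) T) :
    Periodic r T := by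
  have hshift : IsCurvatureRadius p γ φ fun t => r (t + T) := fun t => by
    rw [← periodic_deriv hγT t, ← periodic_deriv hpT t]
    exact hr (t + T)
  exact congrFun (hshift.unique hr hne)

end CurvatureRadius

section Reparametrization

variable {E : Type*} [NormedAddCommGroup E] [NormedSpace ℝ E] {q : ℝ → E} {φ : ℝ → ℝ} {T P : ℝ}

lemma IsChordSeparated.comp_strictMono (hq : IsChordSeparated q P) (hφ : StrictMono φ)
    (hφT : ∀ t, φ (t + T) = φ t + P) : IsChordSeparated (q ∘ φ) T := by
  rintro a b ⟨hab, hbT⟩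
  obtain ⟨ℓ, hpos, hneg⟩ := hq (φ a) (φ b) ⟨hφ hab, hφT a ▸ hφ hbT⟩
  exact ⟨ℓ, fun t ht => hpos _ ⟨hφ ht.1, hφ ht.2⟩, fun t ht => hneg _ ⟨hφ ht.1, hφT a ▸ hφ ht.2⟩⟩

lemma IsChordSeparated.comp_strictAnti (hq : IsChordSeparated q P) (hqP : Periodic q P)
    (hφ : StrictAnti φ) (hφT : ∀ t, φ (t + T) = φ t - P) : IsChordSeparated (q ∘ φ) T := by
  rintro a b ⟨hab, hbT⟩
  have ha : φ (a + T) + P = φ a := by rw [hφT, sub_add_cancel]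
  have hqa : q (φ (a + T)) = q (φ a) := by rw [← hqP, ha]
  obtain ⟨ℓ, hpos, hneg⟩ := hq (φ (a + T)) (φ b) ⟨hφ hbT, ha ▸ hφ hab⟩
  rw [hqa] at hpos hneg
  exact ⟨-ℓ, fun t ht => neg_lt_neg (hneg _ ⟨hφ ht.2, ha ▸ hφ ht.1⟩),
    fun t ht => neg_lt_neg (hpos _ ⟨hφ ht.2, hφ ht.1⟩)⟩

lemma strictMono_or_strictAnti_of_deriv_ne_zero {f : ℝ → ℝ} (hne : ∀ t, deriv f t ≠ 0) :
    StrictMono f ∨ StrictAnti f := by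
  have hderiv (t : ℝ) : HasDerivWithinAt f (deriv f t) univ t :=
    (differentiableAt_of_deriv_ne_zero (hne t)).hasDerivAt.hasDerivWithinAt
  rcases hasDerivWithinAt_forall_lt_or_forall_gt_of_forall_ne convex_univ (fun t _ => hderiv t)
    (fun t _ => hne t) with hneg | hpos
  · exact .inr (strictAnti_of_deriv_neg fun t => hneg t (mem_univ t))
  · exact .inl (strictMono_of_deriv_pos fun t => hpos t (mem_univ t))

variable {p γ : ℝ → Plane}

lemma IsConvexCurveParam.isChordSeparated_comp (hp : IsConvexCurveParam p)
    (hφ : ∀ t, deriv φ t ≠ 0) (hT : ClosesAfterOneTurn γ φ T) : IsChordSeparated (p ∘ φ) T := by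
  have hlt : (0 : ℝ) < 0 + T := by simpa only [zero_add] using hT.period_pos
  have hpi := Real.two_pi_pos
  rcases hT.one_turn with hturn | hturn <;>
    rcases strictMono_or_strictAnti_of_deriv_ne_zero hφ with hmono | hanti
  · exact hp.isChordSeparated.comp_strictMono hmono hturn
  · linarith [hanti hlt, hturn 0]
  · linarith [hmono hlt, hturn 0]
  · exact hp.isChordSeparated.comp_strictAnti hp.periodic hanti hturn

lemma IsConvexCurveParam.periodic_comp (hp : IsConvexCurveParam p)
    (hT : ClosesAfterOneTurn γ φ T) : Periodic (p ∘ φ) T := fun t => by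
  rcases hT.one_turn with hturn | hturn
  · rw [comp_apply, hturn, hp.periodic, comp_apply]
  · rw [comp_apply, hturn, hp.periodic.sub_eq, comp_apply]

end Reparametrization

end MinkowskiPlane

theorem mainTheorem8_general
    (p : ℝ → MinkowskiPlane.Plane) (hp : MinkowskiPlane.IsConvexCurveParam p)
    (hsmooth : ContDiff ℝ ∞ p)
    (γ : ℝ → MinkowskiPlane.Plane) (φ : ℝ → ℝ) (hγ : MinkowskiPlane.IsFrontH γ φ)
    (T : ℝ) (hT : MinkowskiPlane.ClosesAfterOneTurn γ φ T) :
    ∃ r : ℝ → ℝ, MinkowskiPlane.IsCurvatureRadius p γ φ r ∧ ContDiff ℝ ∞ r ∧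
      4 ≤ (MinkowskiPlane.vertices r T).encard := by
  obtain ⟨r, hr, hcurv⟩ := hp.exists_isCurvatureRadius hsmooth hγ
  have hqT := hp.periodic_comp hT
  have hrT := hcurv.periodic (hp.deriv_comp_ne_zero hγ) hT.periodic hqT
  have hq : Differentiable ℝ (p ∘ φ) := (hsmooth.comp hγ.smooth_angle).differentiable (by simp)
  have hsep := hp.isChordSeparated_comp hγ.angle_regular hT
  exact ⟨r, hcurv, hr, hsep.four_le_encard_vertices hT.period_pos hq
    (hγ.smooth_curve.differentiable (by simp)) (hr.differentiable (by simp)) hqT hT.periodic hrT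
    hcurv⟩

theorem mainTheorem8
    (N : Seminorm ℝ MinkowskiPlane.Plane) (hN : ∀ x, N x = 0 → x = 0)
    (p : ℝ → MinkowskiPlane.Plane) (hp : MinkowskiPlane.IsUnitCircleParam N p)
    (γ : ℝ → MinkowskiPlane.Plane) (φ : ℝ → ℝ) (hγ : MinkowskiPlane.IsFrontH γ φ)
    (T : ℝ) (hT : MinkowskiPlane.ClosesAfterOneTurn γ φ T) :
    ∃ r : ℝ → ℝ, MinkowskiPlane.IsCurvatureRadius p γ φ r ∧ ContDiff ℝ ∞ r ∧
      4 ≤ (MinkowskiPlane.vertices r T).encard :=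
  mainTheorem8_general p hp.isConvexCurveParam hp.smooth γ φ hγ T hT
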